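/- Consider the surface of the cube $[-1,1]^3$, a source point $S=(s_1,s_2,-1)$ in the interior of the bottom face and a target point $T=(t_1,t_2,1)$ in the interior of the opposite (top) face, so $|s_i|<1$ and $|t_i|<1$. Assume that $S$ or $T$ is the centroid of its face. Roll the cube over its edges on the plane $z=-1$ (with coordinates $(x,y)$) in the directions R, U, L, D, starting from the base square $[-1,1]^2$. A sequence $w$ of rolls gives a partial unfolding (the union of the squares on which the cube comes to rest) and, if the top face ends up on the plane, an image $T_w$ of the target point in the last square. The straight segment $ST_w$ is called a locally shortest path ($\mathcal{LS}$-path) if it lies in the interior of the partial unfolding. A 3-face path has $w\in\{RR,UU,LL,DD\}$. For $w=dd$ and a direction $e$ perpendicular to $d$ (with $d,e$ also denoting unit vectors), the corner move with pivot $P=3d+e$ swings the target square by $90^\circ$ about $P$ and gives the 4-face sequence $ded$; the corner move with pivot $P=d+e$ swings the source square and gives the 4-face sequence $ede$. The decision angle of such a corner move is $\angle SPT_{dd}$. Then the following hold. 1. All four 3-face paths are $\mathcal{LS}$-paths. 2. If $T$ is the centroid of its face, then for every 3-face path both decision angles $\angle SPT_{dd}$ at the pivots $P=3d+e$ of the target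 square are less than $135^\circ$, and $|ST_{dd}|<|ST_{ded}|$. If $S$ is the centroid of its face, then for every 3-face path both decision angles $\angle SPT_{dd}$ at the pivots $P=d+e$ of the source square are less than $135^\circ$, and $|ST_{dd}|<|ST_{ede}|$. So no such corner move shortens a 3-face path. 3. A shortest path from $S$ to $T$ among all continuous paths on the cube surface exists. Every shortest path is, up to parametrization, one of the four 3-face $\mathcal{LS}$-paths; its length is the length $|ST_{dd}|$ of the corresponding segment, and it meets exactly three faces of the cube. In particular, a shortest path never traverses four faces. -/

import Mathlib

open Set EuclideanGeometry

/-- The plane of the unfolding grid; it is identified with the plane `z = -1` of space, on which the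
cube is rolled. -/
abbrev GridPlane := EuclideanSpace ℝ (Fin 2)

/-- Euclidean space, containing the cube `[-1, 1]³`. -/
abbrev Space3 := EuclideanSpace ℝ (Fin 3)

/-- The surface of the cube `[-1, 1]³`. -/
def cubeSurface : Set Space3 := {p | (∀ i, |p i| ≤ 1) ∧ ∃ i, |p i| = 1}

/-- The six closed faces: `cubeFace (i, true)` lies in the plane `p i = 1` and `cubeFace (i, false)`
in the plane `p i = -1`. -/
def cubeFace (f : Fin 3 × Bool) : Set Space3 :=
  {p | p ∈ cubeSurface ∧ p f.1 = if f.2 then 1 else -1}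

/-- A point of the grid plane, seen in the plane `z = -1` of space. For a point of the base square
`[-1, 1]²` this is the corresponding point of the bottom (source) face of the cube. -/
noncomputable def bottomPoint (q : GridPlane) : Space3 := !₂[q 0, q 1, -1]

/-- The point of the top (target) face of the cube that lies vertically above a point of the base
square. -/
noncomputable def topPoint (q : GridPlane) : Space3 := !₂[q 0, q 1, 1]

/-! ### Paths on the surface -/

/-- The length of a path in space. -/
noncomputable def pathLength {p q : Space3} (γ : Path p q) : ENNReal :=
  eVariationOn (fun t : unitInterval => γ t) univ

/-- `γ` is a shortest path on the cube surface between its endpoints, among all continuous paths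
that stay on the surface. -/
def IsShortestSurfacePath {p q : Space3} (γ : Path p q) : Prop :=
  (∀ t, γ t ∈ cubeSurface) ∧
    ∀ γ' : Path p q, (∀ t, γ' t ∈ cubeSurface) → pathLength γ ≤ pathLength γ'

/-- The faces of the cube that a path meets. -/
def facesMet {p q : Space3} (γ : Path p q) : Set (Fin 3 × Bool) :=
  {f | ∃ t, γ t ∈ cubeFace f}

/-! ### Rolling the cube and unfolding it -/

/-- The four directions in which the cube can be rolled over an edge: R, U, L, D. -/
inductive RollDir where
  | right
  | up
  | left
  | down

/-- The unit vector of a rolling direction. -/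
noncomputable def RollDir.vec : RollDir → GridPlane
  | .right => !₂[1, 0]
  | .up => !₂[0, 1]
  | .left => !₂[-1, 0]
  | .down => !₂[0, -1]

/-- The rotation of space by `90°` that rolls the cube `[-1, 1]³`, resting on the plane `z = -1`,
over its bottom edge in the given direction. For instance, rolling to the right fixes the line
`x = 1, z = -1` and brings the face `x = 1` into the plane `z = -1`. -/
noncomputable def rollBase : RollDir → Space3 → Space3
  | .right, p => !₂[2 + p 2, p 1, -p 0]
  | .up, p => !₂[p 0, 2 + p 2, -p 1]
  | .left, p => !₂[-2 - p 2, p 1, p 0]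
  | .down, p => !₂[p 0, -2 - p 2, p 1]

/-- The same rotation when the cube rests on the grid square centred at `c`. -/
noncomputable def rollFrom (c : GridPlane) (d : RollDir) (p : Space3) : Space3 :=
  !₂[c 0, c 1, 0] + rollBase d (p - !₂[c 0, c 1, 0])

/-- Where a point `p` of the cube is carried by a sequence of rolls, performed from left to right,
starting from the grid square centred at `c`. -/
noncomputable def placeFrom : GridPlane → List RollDir → Space3 → Space3
  | _, [], p => p
  | c, d :: w, p => placeFrom (c + (2 : ℝ) • d.vec) w (rollFrom c d p)

/-- Where a point of the cube is carried by a sequence of rolls that starts on the base square. -/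
noncomputable def place (w : List RollDir) (p : Space3) : Space3 := placeFrom 0 w p

/-- The centre of the grid square on which the cube rests after a sequence of rolls. -/
noncomputable def cellCentre (w : List RollDir) : GridPlane :=
  (w.map fun d => (2 : ℝ) • d.vec).sum

/-- The grid square on which the cube rests after a sequence of rolls. -/
def cell (w : List RollDir) : Set GridPlane := {q | ∀ i, |q i - cellCentre w i| ≤ 1}

/-- The partial unfolding given by a roll sequence: the union of all grid squares on which the cube
comes to rest, including the base square. -/
def unfolding (w : List RollDir) : Set GridPlane := {q | ∃ u, u <+: w ∧ q ∈ cell u}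

/-- The image in the grid plane of the target point `topPoint T` under a roll sequence `w`
(one that ends with the target face on the plane). -/
noncomputable def targetImage (w : List RollDir) (T : GridPlane) : GridPlane :=
  !₂[place w (topPoint T) 0, place w (topPoint T) 1]

/-- The point `p` of the cube surface is printed at the point `q` of the partial unfolding given by
`w`: at some stage of the rolling, `p` touches the plane at `q`, inside the current square. -/
def PrintedAt (w : List RollDir) (p : Space3) (q : GridPlane) : Prop :=
  ∃ u, u <+: w ∧ q ∈ cell u ∧ place u p = bottomPoint q

/-- The straight segment from the source point to the target image of the roll sequence `w` lies in
the interior of the partial unfolding, so that it is a locally shortest path and not a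
pseudopath. -/
def IsLocallyShortest (w : List RollDir) (S T : GridPlane) : Prop :=
  segment ℝ S (targetImage w T) ⊆ interior (unfolding w)

/-- The path `γ` on the cube is, up to parametrization, the locally shortest path of the roll
sequence `w`: in the partial unfolding it is the segment from `S` to the target image, traversed
monotonically. It runs through one face more than the number of rolls. -/
def IsLSPath (w : List RollDir) (S T : GridPlane)
    (γ : Path (bottomPoint S) (topPoint T)) : Prop :=
  IsLocallyShortest w S T ∧
    ∃ φ : unitInterval → ℝ, Continuous φ ∧ Monotone φ ∧ φ 0 = 0 ∧ φ 1 = 1 ∧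
      ∀ t, PrintedAt w (γ t) (AffineMap.lineMap S (targetImage w T) (φ t))

/-! ### Corner moves of the 3-face paths

The 3-face path with roll sequence `d d` runs through three squares in a row. Let `e` be
perpendicular to `d`. Swinging the target square by `90°` towards `e` gives the roll sequence
`d e d`; swinging instead the source square (that is, turning the other two squares relative to it)
gives the roll sequence `e d e`. -/

/-- The pivot of the corner move that swings the target square of `d d` towards `e`: the end on
the side of `e` of the edge between the second and the third square. -/
noncomputable def targetPivot (d e : RollDir) : GridPlane := (3 : ℝ) • d.vec + e.vec

/-- The pivot of the corner move that swings the source square of `d d` on the side of `e`: the end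
on the side of `e` of the edge between the first and the second square. -/
noncomputable def sourcePivot (d e : RollDir) : GridPlane := d.vec + e.vec

/-! Minimality is proved by a calibration. Suppose first that the target is the centre of the top
face. `centerDist` is continuous and vanishes there. On the top face and on each side face it is the
distance to a single apex, the centre of the top face unfolded into the plane of that face. On the
bottom face it is the smallest of the distances to the four apices given by the 3-face unfoldings.
Hence it is 1-Lipschitz on each face (`centerDist_sub_le`), and a path on the surface is at least as
long as the drop of `centerDist` along it, however often it changes faces
(`ofReal_sub_le_eVariationOn_of_cover`). The total drop is the length of the shortest of the four
strip segments, and folding that segment gives a path attaining the bound, so existence needs no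
compactness argument on paths.

A path attaining the bound has no slack on any subpath (`dist_le_of_calibrated`), so it runs
straight towards the apex of the face it is on. It must cross bottom, one side and top in this
order, and the three pieces fit together to one segment in the unfolded strip
(`exists_foldPoint_of_calibrated`).

A centroid source is reduced to this case by reversing time and exchanging the bottom and top faces
(`StripMinimal.symm`). The statements on corner moves are coordinate inequalities. -/

/-! ### Calibrations -/

/-- A real function that is 1-Lipschitz on each of finitely many closed sets covering a path
decreases along the path by at most the length of the path. -/
theorem ofReal_sub_le_eVariationOn_of_cover {X ι : Type*} [PseudoMetricSpace X] [DecidableEq ι]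
    (A : ι → Set X) (hA : ∀ i, IsClosed (A i)) (f : X → ℝ)
    (hf : ∀ i, ∀ p ∈ A i, ∀ q ∈ A i, f p - f q ≤ dist p q)
    (γ : unitInterval → X) (hγ : Continuous γ) (s : Finset ι) :
    ∀ a b : unitInterval, a ≤ b → (∀ t ∈ Icc a b, ∃ i ∈ s, γ t ∈ A i) →
      ENNReal.ofReal (f (γ a) - f (γ b)) ≤ eVariationOn γ (Icc a b) := by
  induction s using Finset.strongInduction with
  | H s ih =>
    intro a b hab hcov
    obtain ⟨i, his, hai⟩ := hcov a (left_mem_Icc.2 hab)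
    have hclosed : IsClosed (γ ⁻¹' A i) := (hA i).preimage hγ
    -- With `τ` the last visit to `A i`, the Lipschitz bound applies directly to the endpoints `γ a`
    -- and `γ τ`, whatever the path does between them. After `τ` the set `A i` is never met again,
    -- so the induction can drop `i`.
    obtain ⟨τ, ⟨⟨haτ, hτb⟩, hτi⟩, hmax⟩ :=
      (isCompact_Icc.inter_right hclosed : IsCompact (Icc a b ∩ γ ⁻¹' A i)).exists_isGreatest
        ⟨a, left_mem_Icc.2 hab, hai⟩
    have hfirst : ENNReal.ofReal (f (γ a) - f (γ τ)) ≤ eVariationOn γ (Icc a τ) :=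
      calc ENNReal.ofReal (f (γ a) - f (γ τ)) ≤ ENNReal.ofReal (dist (γ a) (γ τ)) :=
            ENNReal.ofReal_le_ofReal (hf i _ hai _ hτi)
        _ = edist (γ a) (γ τ) := (edist_dist _ _).symm
        _ ≤ _ := eVariationOn.edist_le γ (left_mem_Icc.2 haτ) (right_mem_Icc.2 haτ)
    rcases hτb.eq_or_lt with rfl | hτb'
    · exact hfirst
    have hopen : ∀ t ∈ Ioc τ b, γ t ∈ ⋃ j ∈ s.erase i, A j := by
      intro t ht
      obtain ⟨j, hjs, hj⟩ := hcov t ⟨haτ.trans ht.1.le, ht.2⟩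
      have hji : j ≠ i := by
        rintro rfl
        exact absurd (hmax ⟨⟨haτ.trans ht.1.le, ht.2⟩, hj⟩) (not_le.2 ht.1)
      exact mem_biUnion (Finset.mem_coe.2 (Finset.mem_erase.2 ⟨hji, hjs⟩)) hj
    have hcl : IsClosed (γ ⁻¹' ⋃ j ∈ s.erase i, A j) :=
      (isClosed_biUnion_finset fun j _ => hA j).preimage hγ
    -- Closedness of the remaining sets extends the cover to the time `τ` itself, which the
    -- induction hypothesis requires.
    have hall : ∀ t ∈ Icc τ b, γ t ∈ ⋃ j ∈ s.erase i, A j := by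
      rw [← closure_Ioc hτb'.ne]
      exact hcl.closure_subset_iff.2 hopen
    have hsecond := ih (s.erase i) (Finset.erase_ssubset his) τ b hτb (fun t ht => by
      simpa only [mem_iUnion, exists_prop] using hall t ht)
    have hadd : eVariationOn γ (Icc a τ) + eVariationOn γ (Icc τ b) = eVariationOn γ (Icc a b) := by
      simpa only [univ_inter] using
        eVariationOn.Icc_add_Icc γ (s := univ) haτ hτb (mem_univ τ)
    calc ENNReal.ofReal (f (γ a) - f (γ b))
        = ENNReal.ofReal ((f (γ a) - f (γ τ)) + (f (γ τ) - f (γ b))) := by ring_nf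
      _ ≤ ENNReal.ofReal (f (γ a) - f (γ τ)) + ENNReal.ofReal (f (γ τ) - f (γ b)) :=
          ENNReal.ofReal_add_le
      _ ≤ _ := by rw [← hadd]; exact add_le_add hfirst hsecond

/-- If a calibration bounds the length of every subpath from below and is attained on the whole
path, then it bounds all distances along the path from above. -/
theorem dist_le_of_calibrated {X : Type*} [PseudoMetricSpace X] (γ : unitInterval → X)
    (g : unitInterval → ℝ)
    (hlow : ∀ a b : unitInterval, a ≤ b →
      ENNReal.ofReal (g a - g b) ≤ eVariationOn γ (Icc a b))
    (h01 : 0 ≤ g 0 - g 1)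
    (htot : eVariationOn γ univ ≤ ENNReal.ofReal (g 0 - g 1)) {s t : unitInterval} (hst : s ≤ t) :
    dist (γ s) (γ t) ≤ g s - g t := by
  have h0 : (0 : unitInterval) ≤ s := unitInterval.nonneg'
  have h1 : t ≤ (1 : unitInterval) := unitInterval.le_one'
  have e1 : eVariationOn γ (Icc 0 s) + eVariationOn γ (Icc s t) = eVariationOn γ (Icc 0 t) := by
    simpa only [univ_inter] using eVariationOn.Icc_add_Icc γ (s := univ) h0 hst (mem_univ s)
  have e2 : eVariationOn γ (Icc 0 t) + eVariationOn γ (Icc t 1) = eVariationOn γ (Icc 0 1) := by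
    simpa only [univ_inter] using
      eVariationOn.Icc_add_Icc γ (s := univ) (h0.trans hst) h1 (mem_univ t)
  have e3 : (Icc 0 1 : Set unitInterval) = univ :=
    eq_univ_of_forall fun x => ⟨unitInterval.nonneg', unitInterval.le_one'⟩
  rw [e3, ← e1] at e2
  have hfin : eVariationOn γ univ ≠ ⊤ := ne_top_of_le_ne_top ENNReal.ofReal_ne_top htot
  rw [← e2] at hfin htot
  obtain ⟨⟨f1, f2⟩, f3⟩ : (eVariationOn γ (Icc 0 s) ≠ ⊤ ∧ eVariationOn γ (Icc s t) ≠ ⊤) ∧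
      eVariationOn γ (Icc t 1) ≠ ⊤ := by
    simpa only [ne_eq, ENNReal.add_eq_top, not_or] using hfin
  -- The outer pieces are at least as long as their drops of `g`, and the whole is at most the total
  -- drop; what is left bounds the middle piece.
  have l1 := (ENNReal.ofReal_le_iff_le_toReal f1).1 (hlow 0 s h0)
  have l3 := (ENNReal.ofReal_le_iff_le_toReal f3).1 (hlow t 1 h1)
  have l := ENNReal.toReal_le_of_le_ofReal h01 htot
  rw [ENNReal.toReal_add (ENNReal.add_ne_top.2 ⟨f1, f2⟩) f3, ENNReal.toReal_add f1 f2] at l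
  have hd : edist (γ s) (γ t) ≤ eVariationOn γ (Icc s t) :=
    eVariationOn.edist_le γ (left_mem_Icc.2 hst) (right_mem_Icc.2 hst)
  rw [edist_dist, ENNReal.ofReal_le_iff_le_toReal f2] at hd
  linarith

/-- A point at which the triangle inequality is an equality, as a homothetic image. -/
theorem sub_eq_smul_of_dist_add_dist_le {E : Type*} [NormedAddCommGroup E] [InnerProductSpace ℝ E]
    {a x c : E} (hac : 0 < dist a c) (h : dist a x + dist x c ≤ dist a c) :
    x - c = (dist x c / dist a c) • (a - c) := by
  have hw : Wbtw ℝ a x c := dist_add_dist_eq_iff.1 (le_antisymm h (dist_triangle a x c))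
  obtain ⟨r, ⟨hr0, hr1⟩, rfl⟩ := hw
  have hd : dist (AffineMap.lineMap a c r) c = (1 - r) * dist a c := by
    rw [dist_lineMap_right, Real.norm_of_nonneg (by linarith)]
  rw [hd, mul_div_assoc, div_self hac.ne', mul_one, AffineMap.lineMap_apply_module]
  module

/-! ### Coordinates adapted to a rolling direction -/

/-- The coordinate in the rolling direction of a point with horizontal coordinates `x`, `y`. -/
def RollDir.along : RollDir → ℝ → ℝ → ℝ
  | .right, x, _ => x
  | .up, _, y => y
  | .left, x, _ => -x
  | .down, _, y => -y

/-- The coordinate perpendicular to the rolling direction. -/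
def RollDir.across : RollDir → ℝ → ℝ → ℝ
  | .right, _, y => y
  | .up, x, _ => x
  | .left, _, y => y
  | .down, x, _ => x

/-- The point of space with given coordinates along and across the rolling direction and given
height. -/
noncomputable def RollDir.point : RollDir → ℝ → ℝ → ℝ → Space3
  | .right, a, b, z => !₂[a, b, z]
  | .up, a, b, z => !₂[b, a, z]
  | .left, a, b, z => !₂[-a, b, z]
  | .down, a, b, z => !₂[b, -a, z]

/-- The side face onto which the cube is rolled. -/
def RollDir.face : RollDir → Fin 3 × Bool
  | .right => (0, true)
  | .up => (1, true)
  | .left => (0, false)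
  | .down => (1, false)

theorem RollDir.point_along_across (d : RollDir) (p : Space3) :
    d.point (d.along (p 0) (p 1)) (d.across (p 0) (p 1)) (p 2) = p := by
  cases d <;> ext i <;> fin_cases i <;> simp [RollDir.point, RollDir.along, RollDir.across]

theorem RollDir.along_point (d : RollDir) (a b z : ℝ) :
    d.along (d.point a b z 0) (d.point a b z 1) = a := by
  cases d <;> simp [RollDir.point, RollDir.along]

theorem RollDir.across_point (d : RollDir) (a b z : ℝ) :
    d.across (d.point a b z 0) (d.point a b z 1) = b := by
  cases d <;> simp [RollDir.point, RollDir.across]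

theorem RollDir.point_two (d : RollDir) (a b z : ℝ) : d.point a b z 2 = z := by
  cases d <;> simp [RollDir.point]

theorem RollDir.dist_point (d : RollDir) (p : Space3) (a b z : ℝ) :
    dist p (d.point a b z) = √((d.along (p 0) (p 1) - a) ^ 2 +
      (d.across (p 0) (p 1) - b) ^ 2 + (p 2 - z) ^ 2) := by
  rw [EuclideanSpace.dist_eq, Fin.sum_univ_three]
  congr 1
  cases d <;>
    simp [RollDir.point, RollDir.along, RollDir.across, Real.dist_eq, sq_abs] <;> ring

theorem RollDir.continuous_along (d : RollDir) :
    Continuous fun p : Space3 => d.along (p 0) (p 1) := by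
  cases d <;> simp only [RollDir.along] <;> fun_prop

theorem RollDir.continuous_across (d : RollDir) :
    Continuous fun p : Space3 => d.across (p 0) (p 1) := by
  cases d <;> simp only [RollDir.across] <;> fun_prop

/-! ### The distance from the centre of the top face -/

/-- The distance on the cube surface from the centre of the top face. -/
noncomputable def centerDist (p : Space3) : ℝ :=
  √((2 - p 2 - p 2 * (1 - max |p 0| |p 1|)) ^ 2 + (min |p 0| |p 1|) ^ 2)

theorem continuous_centerDist : Continuous centerDist := by
  unfold centerDist
  fun_prop

theorem max_sq_add_min_sq_abs (x y : ℝ) : (max |x| |y|) ^ 2 + (min |x| |y|) ^ 2 = x ^ 2 + y ^ 2 := by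
  rcases le_total |x| |y| with h | h <;> simp [h, sq_abs, add_comm]

theorem RollDir.sq_along_add_sq_across (d : RollDir) (x y : ℝ) :
    d.along x y ^ 2 + d.across x y ^ 2 = x ^ 2 + y ^ 2 := by
  cases d <;> simp [RollDir.along, RollDir.across] <;> ring

theorem RollDir.abs_along_le_max (d : RollDir) (x y : ℝ) : |d.along x y| ≤ max |x| |y| := by
  cases d <;> simp [RollDir.along]

theorem RollDir.abs_across_le_max (d : RollDir) (x y : ℝ) : |d.across x y| ≤ max |x| |y| := by
  cases d <;> simp [RollDir.across]

theorem RollDir.exists_along_eq_max (x y : ℝ) : ∃ d : RollDir, d.along x y = max |x| |y| := by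
  rcases le_total |x| |y| with h | h
  · rcases abs_choice y with hy | hy
    · exact ⟨.up, by rw [max_eq_right h, hy]; rfl⟩
    · exact ⟨.down, by rw [max_eq_right h, hy]; rfl⟩
  · rcases abs_choice x with hx | hx
    · exact ⟨.right, by rw [max_eq_left h, hx]; rfl⟩
    · exact ⟨.left, by rw [max_eq_left h, hx]; rfl⟩

theorem centerDist_eq (p : Space3) : centerDist p =
    √((2 - p 2 - p 2 * (1 - max |p 0| |p 1|)) ^ 2 + (p 0 ^ 2 + p 1 ^ 2 - max |p 0| |p 1| ^ 2)) := by
  rw [centerDist, ← max_sq_add_min_sq_abs (p 0) (p 1), add_sub_cancel_left]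

/-- With `M = max |p 0| |p 1|`, the first squared term of `centerDist` has base `M` on the top, `2 -
p 2` on a side (where `M = 1`) and `4 - M` on the bottom. One formula thus covers all faces, and
this lemma and the next three identify the apices. -/
theorem centerDist_top (d : RollDir) {p : Space3} (hp : p 2 = 1) :
    centerDist p = dist p (d.point 0 0 1) := by
  rw [centerDist_eq, d.dist_point, hp]
  congr 1
  linear_combination -d.sq_along_add_sq_across (p 0) (p 1)

theorem centerDist_side (d : RollDir) {p : Space3} (hp : d.along (p 0) (p 1) = 1)
    (hm : max |p 0| |p 1| = 1) : centerDist p = dist p (d.point 1 0 2) := by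
  rw [centerDist_eq, d.dist_point, hm, hp]
  congr 1
  have := d.sq_along_add_sq_across (p 0) (p 1)
  rw [hp] at this
  linear_combination -this

theorem centerDist_bottom_le (d : RollDir) {p : Space3} (hp : p 2 = -1) :
    centerDist p ≤ dist p (d.point 4 0 (-1)) := by
  rw [centerDist_eq, d.dist_point, hp]
  apply Real.sqrt_le_sqrt
  have h1 := d.sq_along_add_sq_across (p 0) (p 1)
  have h2 := (le_abs_self _).trans (d.abs_along_le_max (p 0) (p 1))
  linarith

theorem centerDist_bottom_eq (d : RollDir) {p : Space3} (hp : p 2 = -1)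
    (hd : d.along (p 0) (p 1) = max |p 0| |p 1|) :
    centerDist p = dist p (d.point 4 0 (-1)) := by
  rw [centerDist_eq, d.dist_point, hp]
  congr 1
  have h1 := d.sq_along_add_sq_across (p 0) (p 1)
  rw [← hd]
  linear_combination -h1

theorem max_abs_le_one_of_mem {p : Space3} (hp : p ∈ cubeSurface) : max |p 0| |p 1| ≤ 1 :=
  max_le (hp.1 0) (hp.1 1)

theorem max_abs_eq_one_of_along_eq {d : RollDir} {p : Space3} (hp : p ∈ cubeSurface)
    (h : d.along (p 0) (p 1) = 1) : max |p 0| |p 1| = 1 :=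
  le_antisymm (max_abs_le_one_of_mem hp)
    (h ▸ (le_abs_self _).trans (d.abs_along_le_max (p 0) (p 1)))

/-- Every face is the top, the bottom, or the side face of a rolling direction. -/
theorem cubeFace_cases (i : Fin 3 × Bool) :
    (∀ p ∈ cubeFace i, p 2 = 1) ∨ (∀ p ∈ cubeFace i, p 2 = -1) ∨
      ∃ d : RollDir, ∀ p ∈ cubeFace i, d.along (p 0) (p 1) = 1 := by
  obtain ⟨i, b⟩ := i
  fin_cases i <;> cases b
  · exact .inr (.inr ⟨.left, fun p hp => by have := hp.2; simp_all [RollDir.along]⟩)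
  · exact .inr (.inr ⟨.right, fun p hp => by have := hp.2; simp_all [RollDir.along]⟩)
  · exact .inr (.inr ⟨.down, fun p hp => by have := hp.2; simp_all [RollDir.along]⟩)
  · exact .inr (.inr ⟨.up, fun p hp => by have := hp.2; simp_all [RollDir.along]⟩)
  · exact .inr (.inl fun p hp => by have := hp.2; simp_all)
  · exact .inl fun p hp => by have := hp.2; simp_all

theorem centerDist_sub_le (i : Fin 3 × Bool) (p : Space3) (hp : p ∈ cubeFace i) (q : Space3)
    (hq : q ∈ cubeFace i) : centerDist p - centerDist q ≤ dist p q := by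
  rw [sub_le_iff_le_add]
  rcases cubeFace_cases i with h | h | ⟨d, h⟩
  · rw [centerDist_top .up (h p hp), centerDist_top .up (h q hq)]
    exact dist_triangle _ _ _
  · obtain ⟨d, hd⟩ := RollDir.exists_along_eq_max (q 0) (q 1)
    rw [centerDist_bottom_eq d (h q hq) hd]
    exact (centerDist_bottom_le d (h p hp)).trans (dist_triangle _ _ _)
  · rw [centerDist_side d (h p hp) (max_abs_eq_one_of_along_eq hp.1 (h p hp)),
      centerDist_side d (h q hq) (max_abs_eq_one_of_along_eq hq.1 (h q hq))]
    exact dist_triangle _ _ _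

theorem isClosed_cubeSurface : IsClosed cubeSurface := by
  have h1 : IsClosed (⋂ i, {p : Space3 | |p i| ≤ 1}) :=
    isClosed_iInter fun i => isClosed_le (by fun_prop) continuous_const
  have h2 : IsClosed (⋃ i, {p : Space3 | |p i| = 1}) :=
    isClosed_iUnion_of_finite fun i => isClosed_eq (by fun_prop) continuous_const
  convert h1.inter h2 using 1
  ext p
  simp [cubeSurface]

theorem isClosed_cubeFace (i : Fin 3 × Bool) : IsClosed (cubeFace i) :=
  isClosed_cubeSurface.inter (isClosed_eq (by fun_prop) continuous_const)

theorem exists_mem_cubeFace {p : Space3} (hp : p ∈ cubeSurface) : ∃ i, p ∈ cubeFace i := by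
  obtain ⟨i, hi⟩ := hp.2
  rcases eq_or_eq_neg_of_abs_eq hi with h | h
  · exact ⟨(i, true), hp, by simpa using h⟩
  · exact ⟨(i, false), hp, by simpa using h⟩

theorem ofReal_centerDist_sub_le {γ : unitInterval → Space3} (hγ : Continuous γ)
    (hs : ∀ t, γ t ∈ cubeSurface) {a b : unitInterval} (hab : a ≤ b) :
    ENNReal.ofReal (centerDist (γ a) - centerDist (γ b)) ≤ eVariationOn γ (Icc a b) :=
  ofReal_sub_le_eVariationOn_of_cover cubeFace isClosed_cubeFace centerDist centerDist_sub_le γ hγ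
    Finset.univ a b hab fun t _ => by simpa using exists_mem_cubeFace (hs t)

/-! ### Folding a strip of three squares around the cube -/

/-- The point of the cube surface at which the point of the strip of three squares in direction `d`
with coordinates `u` along and `v` across the strip comes to rest when the strip is folded. -/
noncomputable def foldPoint (d : RollDir) (u v : ℝ) : Space3 :=
  d.point (min u (min 1 (4 - u))) v (max (-1) (min (u - 2) 1))

/-- The length of the segment representing the 3-face path in direction `d`. -/
noncomputable def stripDist (d : RollDir) (S T : GridPlane) : ℝ :=
  √((4 - d.along (S 0) (S 1) - d.along (T 0) (T 1)) ^ 2 +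
    (d.across (S 0) (S 1) - d.across (T 0) (T 1)) ^ 2)

theorem foldPoint_bottom (d : RollDir) {p : Space3} {u v : ℝ} (h1 : d.along (p 0) (p 1) = u)
    (h2 : d.across (p 0) (p 1) = v) (h3 : p 2 = -1) (hu : u ≤ 1) : p = foldPoint d u v := by
  rw [foldPoint, min_eq_left (le_min hu (by linarith)), min_eq_left (by linarith),
    max_eq_left (by linarith), ← h1, ← h2, ← h3, d.point_along_across]

theorem foldPoint_side (d : RollDir) {p : Space3} {u v : ℝ} (h1 : d.along (p 0) (p 1) = 1)
    (h2 : d.across (p 0) (p 1) = v) (h3 : p 2 = u - 2) (hu : 1 ≤ u) (hu' : u ≤ 3) :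
    p = foldPoint d u v := by
  rw [foldPoint, min_eq_left (by linarith : (1 : ℝ) ≤ 4 - u), min_eq_right hu,
    min_eq_left (by linarith : u - 2 ≤ 1), max_eq_right (by linarith), ← h1, ← h2, ← h3,
    d.point_along_across]

theorem foldPoint_top (d : RollDir) {p : Space3} {u v : ℝ} (h1 : d.along (p 0) (p 1) = 4 - u)
    (h2 : d.across (p 0) (p 1) = v) (h3 : p 2 = 1) (hu : 3 ≤ u) : p = foldPoint d u v := by
  rw [foldPoint, min_eq_right (by linarith : 4 - u ≤ 1), min_eq_right (by linarith : 4 - u ≤ u),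
    min_eq_right (by linarith : 1 ≤ u - 2), max_eq_right (by linarith), ← h1, ← h2, ← h3,
    d.point_along_across]

theorem RollDir.coords_of_sub_eq_smul (d : RollDir) {p q : Space3} {A Z k : ℝ}
    (h : p - d.point A 0 Z = k • (q - d.point A 0 Z)) :
    d.along (p 0) (p 1) - A = k * (d.along (q 0) (q 1) - A) ∧
      d.across (p 0) (p 1) = k * d.across (q 0) (q 1) ∧ p 2 - Z = k * (q 2 - Z) := by
  have h0 := congrArg (fun v : Space3 => v 0) h
  have h1 := congrArg (fun v : Space3 => v 1) h
  have h2 := congrArg (fun v : Space3 => v 2) h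
  cases d <;> simp [RollDir.point, RollDir.along, RollDir.across] at h0 h1 h2 ⊢ <;>
    refine ⟨?_, ?_, ?_⟩ <;> linarith

theorem RollDir.dist_point_pos (d : RollDir) {p : Space3} {A b Z : ℝ}
    (h : d.along (p 0) (p 1) ≠ A) : 0 < dist p (d.point A b Z) := by
  rw [dist_pos]
  rintro rfl
  exact h (d.along_point A b Z)

/-! ### Calibrated paths are folded segments -/

section Core

variable {γ : unitInterval → Space3}

/-- Between two times at which the calibration is the distance from the same apex, a calibrated
path runs straight towards that apex. -/
theorem calibrated_segment {g : Space3 → ℝ}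
    (hd : ∀ s t, s ≤ t → dist (γ s) (γ t) ≤ g (γ s) - g (γ t))
    {a t b : unitInterval} (hat : a ≤ t) (htb : t ≤ b) {c : Space3} (ha : g (γ a) = dist (γ a) c)
    (hb : g (γ b) = dist (γ b) c) (hpos : 0 < dist (γ a) c) :
    γ t - c = (g (γ t) / g (γ a)) • (γ a - c) := by
  have h1 := hd a t hat
  have h2 := hd t b htb
  have h3 := dist_triangle (γ t) (γ b) c
  have h4 := dist_triangle (γ a) (γ t) c
  -- The equality propagates from the two ends to `γ t` by the triangle inequality, without knowing
  -- on which face `γ t` lies.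
  have h5 : g (γ t) = dist (γ t) c := le_antisymm (by linarith) (by linarith)
  rw [h5, ha]
  exact sub_eq_smul_of_dist_add_dist_le hpos (by linarith)

/-- A property that is closed and holds after some time holds at that time. -/
theorem mem_of_forall_gt_mem {X : Type*} [TopologicalSpace X] {γ : unitInterval → X}
    (hγ : Continuous γ) {C : Set X} (hC : IsClosed C) {τ : unitInterval} (hτ : τ < 1)
    (h : ∀ t, τ < t → γ t ∈ C) : γ τ ∈ C := by
  have h1 : closure (Ioc τ 1) ⊆ γ ⁻¹' C :=
    (hC.preimage hγ).closure_subset_iff.2 fun t ht => h t ht.1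
  rw [closure_Ioc hτ.ne] at h1
  exact h1 (left_mem_Icc.2 hτ.le)

theorem exists_last_time {X : Type*} [TopologicalSpace X] {γ : unitInterval → X}
    (hγ : Continuous γ) {C : Set X} (hC : IsClosed C) {a : unitInterval} (ha : γ a ∈ C) :
    ∃ τ, a ≤ τ ∧ γ τ ∈ C ∧ ∀ t, τ < t → γ t ∉ C := by
  obtain ⟨τ, ⟨hτa, hτ⟩, hmax⟩ :=
    (isCompact_Icc.inter_right (hC.preimage hγ) :
      IsCompact (Icc a 1 ∩ γ ⁻¹' C)).exists_isGreatest ⟨a, ⟨le_rfl, unitInterval.le_one'⟩, ha⟩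
  refine ⟨τ, hτa.1, hτ, fun t ht htC => ?_⟩
  exact absurd (hmax ⟨⟨hτa.1.trans ht.le, unitInterval.le_one'⟩, htC⟩) (not_le.2 ht)

theorem mem_cubeSurface_cases (d : RollDir) {p : Space3} (hp : p ∈ cubeSurface) :
    p 2 = 1 ∨ p 2 = -1 ∨ d.along (p 0) (p 1) = 1 ∨ d.along (p 0) (p 1) = -1 ∨
      |d.across (p 0) (p 1)| = 1 := by
  obtain ⟨i, hi⟩ := hp.2
  fin_cases i <;> cases d <;> simp [RollDir.along, RollDir.across] at hi ⊢ <;>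
    rcases eq_or_eq_neg_of_abs_eq hi with h | h <;> simp [h]

theorem abs_along_le_one (d : RollDir) {p : Space3} (hp : p ∈ cubeSurface) :
    |d.along (p 0) (p 1)| ≤ 1 :=
  (d.abs_along_le_max _ _).trans (max_abs_le_one_of_mem hp)

/-- A path from an interior point of the bottom face to the centre of the top face along which the
calibration `centerDist` decreases at unit speed is the folded segment of a 3-face path. -/
theorem exists_foldPoint_of_calibrated {S : GridPlane} (hS : ∀ i, |S i| < 1) (hγ : Continuous γ)
    (hs : ∀ t, γ t ∈ cubeSurface) (h0 : γ 0 = bottomPoint S) (h1 : γ 1 = topPoint 0)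
    (hd : ∀ s t, s ≤ t → dist (γ s) (γ t) ≤ centerDist (γ s) - centerDist (γ t)) :
    ∃ d : RollDir, centerDist (γ 0) = stripDist d S 0 ∧ ∀ t, γ t = foldPoint d
      (4 - (4 - d.along (S 0) (S 1)) * (centerDist (γ t) / centerDist (γ 0)))
      (d.across (S 0) (S 1) * (centerDist (γ t) / centerDist (γ 0))) := by
  have hz0 : γ 0 2 = -1 := by rw [h0]; simp [bottomPoint]
  have hz1 : γ 1 2 = 1 := by rw [h1]; simp [topPoint]
  have hle1 : ∀ t : unitInterval, t ≤ 1 := fun t => unitInterval.le_one'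
  have hge0 : ∀ t : unitInterval, 0 ≤ t := fun t => unitInterval.nonneg'
  -- the last point on the bottom face
  obtain ⟨τ₁, -, hq, hq'⟩ := exists_last_time hγ
    (isClosed_eq (f := fun p : Space3 => p 2) (g := fun _ => (-1 : ℝ)) (by fun_prop)
      continuous_const) hz0
  change γ τ₁ 2 = -1 at hq
  replace hq' : ∀ t, τ₁ < t → γ t 2 ≠ -1 := hq'
  have hτ₁ : τ₁ < 1 := (hle1 τ₁).lt_of_ne fun h => by rw [h, hz1] at hq; norm_num at hq
  obtain ⟨d, hdmax⟩ := RollDir.exists_along_eq_max (γ τ₁ 0) (γ τ₁ 1)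
  have hfq := centerDist_bottom_eq d hq hdmax
  have hS0 : d.along (γ 0 0) (γ 0 1) = d.along (S 0) (S 1) := by rw [h0]; simp [bottomPoint]
  have hS1 : d.across (γ 0 0) (γ 0 1) = d.across (S 0) (S 1) := by rw [h0]; simp [bottomPoint]
  have hSa : |d.along (S 0) (S 1)| < 1 := (d.abs_along_le_max _ _).trans_lt (max_lt (hS 0) (hS 1))
  have hSb : |d.across (S 0) (S 1)| < 1 :=
    (d.abs_across_le_max _ _).trans_lt (max_lt (hS 0) (hS 1))
  set a := d.along (S 0) (S 1)
  set b := d.across (S 0) (S 1)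
  -- The direction `d` was chosen at the last bottom point; since no length is wasted before it, the
  -- same apex is also nearest to the start.
  have hf0 : centerDist (γ 0) = dist (γ 0) (d.point 4 0 (-1)) := by
    refine le_antisymm (centerDist_bottom_le d hz0) ?_
    have := hd 0 τ₁ (hge0 _)
    have := dist_triangle (γ 0) (γ τ₁) (d.point 4 0 (-1))
    linarith
  have hpos0 : 0 < dist (γ 0) (d.point 4 0 (-1)) :=
    d.dist_point_pos (by rw [hS0]; have := abs_lt.1 hSa; linarith [this.2])
  have hmono : ∀ s t, s ≤ t → centerDist (γ t) ≤ centerDist (γ s) := fun s t hst => by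
    have := hd s t hst
    have := dist_nonneg (x := γ s) (y := γ t)
    linarith
  have hseg0 : ∀ t, t ≤ τ₁ → _ := fun t ht =>
    d.coords_of_sub_eq_smul (calibrated_segment hd (hge0 t) ht hf0 hfq hpos0)
  rw [hS0, hS1, hz0] at hseg0
  -- it lies on the edge to the side face
  have hqa : d.along (γ τ₁ 0) (γ τ₁ 1) = 1 := by
    -- Later points lie on the top or a side, hence so does the limit `γ τ₁`. Its height excludes
    -- the top.
    have hC : IsClosed ({p : Space3 | p 2 = 1} ∪ {p : Space3 | max |p 0| |p 1| = 1}) :=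
      (isClosed_eq (by fun_prop) continuous_const).union
        (isClosed_eq (by fun_prop) continuous_const)
    have hmem := mem_of_forall_gt_mem hγ hC hτ₁ fun t ht => by
      obtain ⟨i, hi⟩ := (hs t).2
      by_cases hz : γ t 2 = 1
      · exact .inl hz
      refine .inr (le_antisymm (max_abs_le_one_of_mem (hs t)) ?_)
      fin_cases i
      · exact le_max_of_le_left hi.ge
      · exact le_max_of_le_right hi.ge
      · rcases eq_or_eq_neg_of_abs_eq hi with h | h
        · exact absurd h hz
        · exact absurd h (hq' t ht)
    rcases hmem with h | h
    · have h : γ τ₁ 2 = 1 := h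
      rw [hq] at h; norm_num at h
    · rw [hdmax]; exact h
  have hmq := max_abs_eq_one_of_along_eq (hs τ₁) hqa
  -- On the common edge the calibration is the distance to both the bottom apex and the side apex,
  -- so the straight pieces can be chained.
  have hfq' := centerDist_side d hqa hmq
  have hposq : 0 < dist (γ τ₁) (d.point 4 0 (-1)) := d.dist_point_pos (by rw [hqa]; norm_num)
  rw [← hfq] at hposq
  rw [← hf0] at hpos0
  obtain ⟨hq1, hq2, -⟩ := hseg0 τ₁ le_rfl
  have hqle := (div_le_one hpos0).2 (hmono 0 τ₁ (hge0 _))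
  have hq0 := div_pos hposq hpos0
  -- Every apex has coordinate `0` across the strip, so moving towards it cannot increase
  -- `|across|`. The path therefore stays off the vertical edges of the side face.
  have hqb : |d.across (γ τ₁ 0) (γ τ₁ 1)| < 1 := by
    rw [hq2, abs_mul, abs_of_pos hq0]
    exact (mul_le_of_le_one_left (abs_nonneg _) hqle).trans_lt hSb
  -- the last point on the side face
  obtain ⟨τ₂, hτ, hr, hr'⟩ := exists_last_time hγ
    (isClosed_eq (g := fun _ => (1 : ℝ)) d.continuous_along continuous_const) hqa
  change d.along (γ τ₂ 0) (γ τ₂ 1) = 1 at hr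
  replace hr' : ∀ t, τ₂ < t → d.along (γ t 0) (γ t 1) ≠ 1 := hr'
  have hτ₂ : τ₂ < 1 := (hle1 τ₂).lt_of_ne fun h => by
    have h0 : d.along 0 0 = 0 := by cases d <;> simp [RollDir.along]
    rw [h, h1] at hr
    simp [topPoint, h0] at hr
  have hmr := max_abs_eq_one_of_along_eq (hs τ₂) hr
  have hfr := centerDist_side d hr hmr
  have hseg1 : ∀ t, τ₁ ≤ t → t ≤ τ₂ → _ := fun t ht ht' =>
    d.coords_of_sub_eq_smul (calibrated_segment hd ht ht' hfq' hfr (hfq' ▸ hposq))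
  rw [hqa, hq] at hseg1
  obtain ⟨-, hr2, hr3⟩ := hseg1 τ₂ hτ le_rfl
  have hrb : |d.across (γ τ₂ 0) (γ τ₂ 1)| < 1 := by
    rw [hr2, abs_mul, abs_of_nonneg (div_nonneg (a := centerDist (γ τ₂)) (Real.sqrt_nonneg _) hposq.le)]
    exact (mul_le_of_le_one_left (abs_nonneg _)
      ((div_le_one hposq).2 (hmono _ _ hτ))).trans_lt hqb
  have hrz : γ τ₂ 2 = 1 := by
    have hC : IsClosed ({p : Space3 | p 2 = 1} ∪ ({p : Space3 | d.along (p 0) (p 1) = -1} ∪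
        {p : Space3 | |d.across (p 0) (p 1)| = 1})) :=
      (isClosed_eq (by fun_prop) continuous_const).union
        ((isClosed_eq d.continuous_along continuous_const).union
          (isClosed_eq d.continuous_across.abs continuous_const))
    have hmem := mem_of_forall_gt_mem hγ hC hτ₂ fun t ht => by
      rcases mem_cubeSurface_cases d (hs t) with h | h | h | h | h
      · exact .inl h
      · exact absurd h (hq' t (hτ.trans_lt ht))
      · exact absurd h (hr' t ht)
      · exact .inr (.inl h)
      · exact .inr (.inr h)
    rcases hmem with h | h | h
    · exact h
    · have h : d.along (γ τ₂ 0) (γ τ₂ 1) = -1 := h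
      rw [hr] at h; norm_num at h
    · exact absurd h hrb.ne
  have hfr' := centerDist_top d hrz
  have hposr : 0 < dist (γ τ₂) (d.point 0 0 1) := d.dist_point_pos (by rw [hr]; norm_num)
  have hseg2 : ∀ t, τ₂ ≤ t → _ := fun t ht =>
    d.coords_of_sub_eq_smul
      (calibrated_segment hd ht (hle1 t) hfr' (centerDist_top d hz1) hposr)
  rw [← hfr'] at hposr
  rw [hr, hrz] at hseg2
  rw [hqa] at hq1
  rw [hrz] at hr3
  refine ⟨d, ?_, fun t => ?_⟩
  · have h00 : d.along 0 0 = 0 ∧ d.across 0 0 = 0 := by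
      cases d <;> simp [RollDir.along, RollDir.across]
    rw [hf0, d.dist_point, hS0, hS1, hz0, stripDist]
    simp only [PiLp.zero_apply, h00]
    congr 1
    ring
  -- In strip coordinates all three apices are the point `(4, 0)`. The successive homotheties
  -- therefore compose to one with that centre, and their ratios multiply.
  have hk : ∀ x : ℝ, x / centerDist (γ 0) =
      x / centerDist (γ τ₁) * (centerDist (γ τ₁) / centerDist (γ 0)) := fun x => by
    field_simp
  rcases le_total t τ₁ with ht | ht
  · obtain ⟨e1, e2, e3⟩ := hseg0 t ht
    refine foldPoint_bottom d (by linarith) (by linarith) (by linarith) ?_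
    have := (abs_le.1 (abs_along_le_one d (hs t))).2
    linarith
  rcases le_total t τ₂ with ht' | ht'
  · obtain ⟨e1, e2, e3⟩ := hseg1 t ht ht'
    have hu : γ t 2 = 4 - (4 - a) * (centerDist (γ t) / centerDist (γ 0)) - 2 := by
      rw [hk]
      linear_combination e3 + centerDist (γ t) / centerDist (γ τ₁) * hq1
    have hz := abs_le.1 ((hs t).1 2)
    refine foldPoint_side d (by linarith) ?_ hu (by linarith [hz.1]) (by linarith [hz.2])
    rw [hk, e2, hq2]
    ring
  · obtain ⟨e1, e2, e3⟩ := hseg2 t ht'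
    have hk' : centerDist (γ t) / centerDist (γ τ₁) = centerDist (γ t) / centerDist (γ τ₂) *
      (centerDist (γ τ₂) / centerDist (γ τ₁)) := by field_simp
    have hu : d.along (γ t 0) (γ t 1) =
        4 - (4 - (4 - a) * (centerDist (γ t) / centerDist (γ 0))) := by
      rw [hk, hk']
      -- On the side face the height below the apex, which is at height `2`, shrinks from `3` to
      -- `1`.
      have : centerDist (γ τ₂) / centerDist (γ τ₁) = 1 / 3 := by linarith
      rw [this]
      linear_combination e1 - centerDist (γ t) / centerDist (γ τ₂) * (1 / 3) * hq1
    have hz := abs_le.1 (abs_along_le_one d (hs t))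
    refine foldPoint_top d hu ?_ (by linarith) (by linarith [hz.2])
    rw [hk, hk', e2, hr2, hq2]
    ring

end Core

/-! ### Minimality of the 3-face paths -/

/-- The length of the shortest of the four 3-face segments bounds from below the length of every
path on the surface, and the paths attaining it are folded 3-face segments. -/
def StripMinimal (S T : GridPlane) : Prop :=
  (∃ d : RollDir, ∀ γ : unitInterval → Space3, Continuous γ → (∀ t, γ t ∈ cubeSurface) →
    γ 0 = bottomPoint S → γ 1 = topPoint T →
      ENNReal.ofReal (stripDist d S T) ≤ eVariationOn γ univ) ∧
  ∀ γ : unitInterval → Space3, Continuous γ → (∀ t, γ t ∈ cubeSurface) →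
    γ 0 = bottomPoint S → γ 1 = topPoint T →
    (∀ d, eVariationOn γ univ ≤ ENNReal.ofReal (stripDist d S T)) →
    ∃ (d : RollDir) (φ : unitInterval → ℝ), Continuous φ ∧ Monotone φ ∧ φ 0 = 0 ∧ φ 1 = 1 ∧
      (∀ t, γ t = foldPoint d
        (d.along (S 0) (S 1) + φ t * (4 - d.along (S 0) (S 1) - d.along (T 0) (T 1)))
        (d.across (S 0) (S 1) + φ t * (d.across (T 0) (T 1) - d.across (S 0) (S 1)))) ∧
      eVariationOn γ univ = ENNReal.ofReal (stripDist d S T)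

theorem RollDir.along_zero (d : RollDir) : d.along 0 0 = 0 := by cases d <;> simp [RollDir.along]

theorem RollDir.across_zero (d : RollDir) : d.across 0 0 = 0 := by
  cases d <;> simp [RollDir.across]

theorem dist_bottomPoint_apex (d : RollDir) (S : GridPlane) :
    dist (bottomPoint S) (d.point 4 0 (-1)) = stripDist d S 0 := by
  rw [d.dist_point, stripDist]
  simp only [PiLp.zero_apply, d.along_zero, d.across_zero]
  congr 1
  simp [bottomPoint]
  ring

theorem exists_centerDist_bottomPoint_eq (S : GridPlane) :
    ∃ d : RollDir, centerDist (bottomPoint S) = stripDist d S 0 := by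
  obtain ⟨d, hd⟩ := RollDir.exists_along_eq_max (bottomPoint S 0) (bottomPoint S 1)
  exact ⟨d, dist_bottomPoint_apex d S ▸ centerDist_bottom_eq d (by simp [bottomPoint]) hd⟩

theorem centerDist_topPoint_zero : centerDist (topPoint 0) = 0 := by
  rw [centerDist_top .up (by simp [topPoint])]
  simp [topPoint, RollDir.point]

theorem Icc_zero_one_unitInterval : (Icc 0 1 : Set unitInterval) = univ :=
  eq_univ_of_forall fun _ => ⟨unitInterval.nonneg', unitInterval.le_one'⟩

theorem centerDist_bottomPoint_pos {S : GridPlane} (hS : ∀ i, |S i| < 1) :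
    0 < centerDist (bottomPoint S) := by
  obtain ⟨d, hd⟩ := exists_centerDist_bottomPoint_eq S
  rw [hd, ← dist_bottomPoint_apex]
  refine d.dist_point_pos ?_
  have h := (le_abs_self _).trans_lt
    ((d.abs_along_le_max (S 0) (S 1)).trans_lt (max_lt (hS 0) (hS 1)))
  simp [bottomPoint]
  linarith

theorem stripMinimal_zero {S : GridPlane} (hS : ∀ i, |S i| < 1) : StripMinimal S 0 := by
  have hlow : ∀ γ : unitInterval → Space3, Continuous γ → (∀ t, γ t ∈ cubeSurface) →
    γ 0 = bottomPoint S → γ 1 = topPoint 0 →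
      ENNReal.ofReal (centerDist (bottomPoint S)) ≤ eVariationOn γ univ := by
    intro γ hγ hs h0 h1
    have := ofReal_centerDist_sub_le hγ hs (unitInterval.nonneg' : 0 ≤ (1 : unitInterval))
    rwa [h0, h1, centerDist_topPoint_zero, sub_zero, Icc_zero_one_unitInterval] at this
  obtain ⟨d₀, hd₀⟩ := exists_centerDist_bottomPoint_eq S
  refine ⟨⟨d₀, hd₀ ▸ hlow⟩, fun γ hγ hs h0 h1 hle => ?_⟩
  have hpos := centerDist_bottomPoint_pos hS
  have hlen : eVariationOn γ univ = ENNReal.ofReal (centerDist (bottomPoint S)) :=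
    le_antisymm (hd₀ ▸ hle d₀) (hlow γ hγ hs h0 h1)
  have hcal : ∀ s t, s ≤ t → dist (γ s) (γ t) ≤ centerDist (γ s) - centerDist (γ t) :=
    fun s t hst => dist_le_of_calibrated γ (fun t => centerDist (γ t))
      (fun a b hab => ofReal_centerDist_sub_le hγ hs hab)
      (by rw [h0, h1, centerDist_topPoint_zero, sub_zero]; exact hpos.le)
      (by rw [hlen, h0, h1, centerDist_topPoint_zero, sub_zero]) hst
  obtain ⟨d, hd, hfold⟩ := exists_foldPoint_of_calibrated hS hγ hs h0 h1 hcal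
  rw [h0] at hd
  -- The parameter on the segment is the fraction of the calibration already used up; it is monotone
  -- because the calibration never increases along the path.
  refine ⟨d, fun t => 1 - centerDist (γ t) / centerDist (bottomPoint S),
    continuous_const.sub ((continuous_centerDist.comp hγ).div_const _), fun s t hst => ?_, ?_, ?_,
    fun t => ?_, hd ▸ hlen⟩
  · have h := hcal s t hst
    have h' := dist_nonneg (x := γ s) (y := γ t)
    exact sub_le_sub_left (div_le_div_of_nonneg_right (by linarith) hpos.le) _
  · simp only [h0, div_self hpos.ne', sub_self]
  · simp only [h1, centerDist_topPoint_zero, zero_div, sub_zero]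
  · rw [hfold t, h0]
    simp only [PiLp.zero_apply, d.along_zero, d.across_zero]
    congr 1 <;> ring

/-! ### Exchanging source and target -/

/-- The reflection that exchanges the bottom and the top face. -/
noncomputable def verticalFlip (p : Space3) : Space3 := !₂[p 0, p 1, -p 2]

theorem dist_verticalFlip (p q : Space3) : dist (verticalFlip p) (verticalFlip q) = dist p q := by
  simp only [EuclideanSpace.dist_eq, Fin.sum_univ_three, verticalFlip, Real.dist_eq, sq_abs]
  congr 1
  simp
  ring

theorem isometry_verticalFlip : Isometry verticalFlip := Isometry.of_dist_eq dist_verticalFlip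

theorem verticalFlip_verticalFlip (p : Space3) : verticalFlip (verticalFlip p) = p := by
  ext i
  fin_cases i <;> simp [verticalFlip]

theorem verticalFlip_mem_cubeSurface {p : Space3} (hp : p ∈ cubeSurface) :
    verticalFlip p ∈ cubeSurface := by
  obtain ⟨h, i, hi⟩ := hp
  refine ⟨fun j => ?_, i, ?_⟩
  · have := h j
    fin_cases j <;> simpa [verticalFlip] using this
  · fin_cases i <;> simpa [verticalFlip] using hi

/-- The flip acts on the strip as the reflection in its middle line `u = 2`. -/
theorem verticalFlip_foldPoint (d : RollDir) (u v : ℝ) :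
    verticalFlip (foldPoint d u v) = foldPoint d (4 - u) v := by
  have h1 : min (4 - u) (min 1 (4 - (4 - u))) = min u (min 1 (4 - u)) := by
    rw [sub_sub_cancel, min_comm 1 u, ← min_assoc, min_comm (4 - u) u, min_assoc,
      min_comm (4 - u) 1]
  have h2 : max (-1) (min (4 - u - 2) 1) = -max (-1) (min (u - 2) 1) := by
    rcases le_total u 1 with h | h
    · rw [min_eq_right (by linarith), min_eq_left (by linarith : u - 2 ≤ 1),
        max_eq_left (by linarith : u - 2 ≤ -1), max_eq_right (by norm_num)]
      norm_num
    rcases le_total u 3 with h' | h'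
    · rw [min_eq_left (by linarith), min_eq_left (by linarith : u - 2 ≤ 1),
        max_eq_right (by linarith : -1 ≤ u - 2), max_eq_right (by linarith)]
      ring
    · rw [min_eq_left (by linarith), min_eq_right (by linarith : 1 ≤ u - 2),
        max_eq_right (by norm_num : (-1 : ℝ) ≤ 1), max_eq_left (by linarith)]
  rw [foldPoint, foldPoint, h1, h2]
  cases d <;> simp [verticalFlip, RollDir.point]

theorem stripDist_comm (d : RollDir) (S T : GridPlane) : stripDist d S T = stripDist d T S := by
  unfold stripDist
  congr 1
  ring

theorem eVariationOn_flip_le (γ : unitInterval → Space3) :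
    eVariationOn (fun t => verticalFlip (γ (unitInterval.symm t))) univ ≤ eVariationOn γ univ := by
  have h1 := (isometry_verticalFlip.lipschitz.lipschitzOnWith (s := univ)).comp_eVariationOn_le
    (g := fun t => γ (unitInterval.symm t)) (s := univ) (mapsTo_univ _ _)
  rw [ENNReal.coe_one, one_mul] at h1
  refine h1.trans (eVariationOn.comp_le_of_antitoneOn γ unitInterval.symm ?_ (mapsTo_univ _ _))
  exact fun a _ b _ hab => unitInterval.strictAnti_symm.antitone hab

theorem StripMinimal.symm {S T : GridPlane} (h : StripMinimal T S) : StripMinimal S T := by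
  obtain ⟨⟨d₀, hd₀⟩, heq⟩ := h
  have hcont : ∀ γ : unitInterval → Space3, Continuous γ →
      Continuous fun t => verticalFlip (γ (unitInterval.symm t)) := fun γ hγ =>
    isometry_verticalFlip.continuous.comp (hγ.comp unitInterval.continuous_symm)
  have hb : ∀ Q, verticalFlip (topPoint Q) = bottomPoint Q := fun Q => by
    ext i; fin_cases i <;> simp [verticalFlip, topPoint, bottomPoint]
  have ht : ∀ Q, verticalFlip (bottomPoint Q) = topPoint Q := fun Q => by
    rw [← hb, verticalFlip_verticalFlip]
  have h0' : ∀ γ : unitInterval → Space3, γ 1 = topPoint T →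
      verticalFlip (γ (unitInterval.symm 0)) = bottomPoint T := fun γ h => by
    rw [unitInterval.symm_zero, h, hb]
  have h1' : ∀ γ : unitInterval → Space3, γ 0 = bottomPoint S →
      verticalFlip (γ (unitInterval.symm 1)) = topPoint S := fun γ h => by
    rw [unitInterval.symm_one, h, ht]
  refine ⟨⟨d₀, fun γ hγ hs h0 h1 => ?_⟩, fun γ hγ hs h0 h1 hle => ?_⟩
  · rw [stripDist_comm]
    exact (hd₀ _ (hcont γ hγ) (fun t => verticalFlip_mem_cubeSurface (hs _)) (h0' γ h1)
      (h1' γ h0)).trans (eVariationOn_flip_le γ)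
  · obtain ⟨d, φ, hφ, hmono, hφ0, hφ1, hfold, hlen⟩ := heq _ (hcont γ hγ)
      (fun t => verticalFlip_mem_cubeSurface (hs _)) (h0' γ h1) (h1' γ h0)
      fun d => (eVariationOn_flip_le γ).trans (stripDist_comm d S T ▸ hle d)
    refine ⟨d, fun t => 1 - φ (unitInterval.symm t),
      continuous_const.sub (hφ.comp unitInterval.continuous_symm), fun s t hst => ?_, ?_, ?_,
      fun t => ?_, ?_⟩
    · exact sub_le_sub_left (hmono (unitInterval.strictAnti_symm.antitone hst)) _
    · simp only [unitInterval.symm_zero, hφ1, sub_self]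
    · simp only [unitInterval.symm_one, hφ0, sub_zero]
    · have h := congrArg verticalFlip (hfold (unitInterval.symm t))
      rw [verticalFlip_verticalFlip, unitInterval.symm_symm, verticalFlip_foldPoint] at h
      rw [h]
      congr 1 <;> ring
    · exact le_antisymm (hle d) (stripDist_comm d S T ▸ hlen ▸ eVariationOn_flip_le γ)

/-! ### The folded segments are paths on the surface -/

theorem foldPoint_coords (u : ℝ) :
    (u ≤ 1 ∧ min u (min 1 (4 - u)) = u ∧ max (-1) (min (u - 2) 1) = -1) ∨
    (1 ≤ u ∧ u ≤ 3 ∧ min u (min 1 (4 - u)) = 1 ∧ max (-1) (min (u - 2) 1) = u - 2) ∨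
    (3 ≤ u ∧ min u (min 1 (4 - u)) = 4 - u ∧ max (-1) (min (u - 2) 1) = 1) := by
  grind

/-- Bending a flat strip does not increase distances. This yields the upper bound on the length of a
folded segment; the lower bound comes from the calibration. -/
theorem dist_foldPoint_le (d : RollDir) (u v u' v' : ℝ) :
    dist (foldPoint d u v) (foldPoint d u' v') ≤ √((u - u') ^ 2 + (v - v') ^ 2) := by
  conv_lhs => rw [foldPoint, foldPoint]
  rw [d.dist_point, d.along_point, d.across_point, d.point_two]
  apply Real.sqrt_le_sqrt
  rcases foldPoint_coords u with ⟨h1, h2, h3⟩ | ⟨h1, h1', h2, h3⟩ | ⟨h1, h2, h3⟩ <;>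
  rcases foldPoint_coords u' with ⟨k1, k2, k3⟩ | ⟨k1, k1', k2, k3⟩ | ⟨k1, k2, k3⟩ <;>
  rw [h2, h3, k2, k3] <;> nlinarith

theorem foldPoint_mem_cubeSurface (d : RollDir) {u v : ℝ} (hu : -1 ≤ u) (hu' : u ≤ 5)
    (hv : |v| ≤ 1) : foldPoint d u v ∈ cubeSurface := by
  unfold foldPoint
  rcases foldPoint_coords u with ⟨h1, h2, h3⟩ | ⟨h1, h1', h2, h3⟩ | ⟨h1, h2, h3⟩ <;>
  rw [h2, h3]
  · have h : |u| ≤ 1 := abs_le.2 ⟨hu, h1⟩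
    refine ⟨fun i => ?_, 2, by rw [d.point_two]; simp⟩
    cases d <;> fin_cases i <;> simp [RollDir.point, h, hv]
  · have h : |u - 2| ≤ 1 := abs_le.2 ⟨by linarith, by linarith⟩
    refine ⟨fun i => ?_, d.face.1, ?_⟩
    · cases d <;> fin_cases i <;> simp [RollDir.point, h, hv]
    · cases d <;> simp [RollDir.point, RollDir.face]
  · have h : |4 - u| ≤ 1 := abs_le.2 ⟨by linarith, by linarith⟩
    have h' : |u - 4| ≤ 1 := by rwa [abs_sub_comm]
    refine ⟨fun i => ?_, 2, by rw [d.point_two]; simp⟩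
    cases d <;> fin_cases i <;> simp [RollDir.point, h, h', hv]

/-- The folded segment of the 3-face path in direction `d`, parametrized by the real line. -/
noncomputable def stripLine (d : RollDir) (S T : GridPlane) (t : ℝ) : Space3 :=
  foldPoint d (d.along (S 0) (S 1) + t * (4 - d.along (S 0) (S 1) - d.along (T 0) (T 1)))
    (d.across (S 0) (S 1) + t * (d.across (T 0) (T 1) - d.across (S 0) (S 1)))

theorem lipschitzWith_stripLine (d : RollDir) (S T : GridPlane) :
    LipschitzWith (stripDist d S T).toNNReal (stripLine d S T) := by
  refine LipschitzWith.of_dist_le_mul fun s t => (dist_foldPoint_le d _ _ _ _).trans_eq ?_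
  rw [Real.coe_toNNReal (stripDist d S T) (Real.sqrt_nonneg _), stripDist, Real.dist_eq, ← Real.sqrt_sq_eq_abs,
    ← Real.sqrt_mul (by positivity)]
  congr 1
  ring

theorem abs_along_lt_one (d : RollDir) {S : GridPlane} (hS : ∀ i, |S i| < 1) :
    |d.along (S 0) (S 1)| < 1 :=
  (d.abs_along_le_max _ _).trans_lt (max_lt (hS 0) (hS 1))

theorem abs_across_lt_one (d : RollDir) {S : GridPlane} (hS : ∀ i, |S i| < 1) :
    |d.across (S 0) (S 1)| < 1 :=
  (d.abs_across_le_max _ _).trans_lt (max_lt (hS 0) (hS 1))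

theorem strip_coords_mem (d : RollDir) {S T : GridPlane} (hS : ∀ i, |S i| < 1)
    (hT : ∀ i, |T i| < 1) {t : ℝ} (ht0 : 0 ≤ t) (ht1 : t ≤ 1) :
    (-1 < d.along (S 0) (S 1) + t * (4 - d.along (S 0) (S 1) - d.along (T 0) (T 1)) ∧
      d.along (S 0) (S 1) + t * (4 - d.along (S 0) (S 1) - d.along (T 0) (T 1)) < 5) ∧
    |d.across (S 0) (S 1) + t * (d.across (T 0) (T 1) - d.across (S 0) (S 1))| < 1 := by
  have h1 := abs_lt.1 (abs_along_lt_one d hS)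
  have h2 := abs_lt.1 (abs_along_lt_one d hT)
  -- The open strip is convex and contains both ends of the segment. The lower bounds follow by
  -- negating coordinates.
  have key : ∀ c x y : ℝ, x < c → y < c → x + t * (y - x) < c := fun c x y hx hy => by
    have := (convex_Iio (𝕜 := ℝ) c) hx hy (sub_nonneg.2 ht1) ht0 (by ring)
    simp only [smul_eq_mul, mem_Iio] at this
    linarith
  refine ⟨⟨?_, ?_⟩, abs_lt.2 ⟨?_, ?_⟩⟩
  · have := key 1 (-d.along (S 0) (S 1)) (-(4 - d.along (T 0) (T 1))) (by linarith) (by linarith)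
    linarith
  · have := key 5 (d.along (S 0) (S 1)) (4 - d.along (T 0) (T 1)) (by linarith) (by linarith)
    linarith
  · have := key 1 (-d.across (S 0) (S 1)) (-d.across (T 0) (T 1))
      (by linarith [abs_lt.1 (abs_across_lt_one d hS)])
      (by linarith [abs_lt.1 (abs_across_lt_one d hT)])
    linarith
  · exact key 1 _ _ (abs_lt.1 (abs_across_lt_one d hS)).2 (abs_lt.1 (abs_across_lt_one d hT)).2

theorem stripLine_zero (d : RollDir) {S : GridPlane} (T : GridPlane) (hS : ∀ i, |S i| < 1) :
    stripLine d S T 0 = bottomPoint S := by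
  have h := abs_lt.1 (abs_along_lt_one d hS)
  rw [stripLine, zero_mul, zero_mul, add_zero, add_zero]
  exact (foldPoint_bottom d (by simp [bottomPoint]) (by simp [bottomPoint])
    (by simp [bottomPoint]) h.2.le).symm

theorem stripLine_one (d : RollDir) (S : GridPlane) {T : GridPlane} (hT : ∀ i, |T i| < 1) :
    stripLine d S T 1 = topPoint T := by
  have h := abs_lt.1 (abs_along_lt_one d hT)
  rw [stripLine]
  exact (foldPoint_top d (by simp [topPoint]; ring) (by simp [topPoint])
    (by simp [topPoint]) (by linarith)).symm

/-- The 3-face path in direction `d`. -/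
noncomputable def stripPath (d : RollDir) {S T : GridPlane} (hS : ∀ i, |S i| < 1)
    (hT : ∀ i, |T i| < 1) : Path (bottomPoint S) (topPoint T) where
  toFun t := stripLine d S T t
  continuous_toFun := (lipschitzWith_stripLine d S T).continuous.comp continuous_subtype_val
  source' := stripLine_zero d T hS
  target' := stripLine_one d S hT

theorem stripPath_mem_cubeSurface (d : RollDir) {S T : GridPlane} (hS : ∀ i, |S i| < 1)
    (hT : ∀ i, |T i| < 1) (t : unitInterval) : stripPath d hS hT t ∈ cubeSurface := by
  obtain ⟨⟨h1, h2⟩, h3⟩ := strip_coords_mem d hS hT t.2.1 t.2.2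
  exact foldPoint_mem_cubeSurface d h1.le h2.le h3.le

theorem pathLength_stripPath_le (d : RollDir) {S T : GridPlane} (hS : ∀ i, |S i| < 1)
    (hT : ∀ i, |T i| < 1) :
    pathLength (stripPath d hS hT) ≤ ENNReal.ofReal (stripDist d S T) := by
  have h1 := ((lipschitzWith_stripLine d S T).lipschitzOnWith (s := univ)).comp_eVariationOn_le
    (g := fun t : unitInterval => (t : ℝ)) (s := univ) (mapsTo_univ _ _)
  have h2 : eVariationOn (fun t : unitInterval => (t : ℝ)) univ = 1 := by
    have h := MonotoneOn.eVariationOn_eq (f := fun t : unitInterval => (t : ℝ)) (s := univ)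
      (fun a _ b _ hab => hab) (mem_univ 0) (mem_univ 1)
    rw [univ_inter, Icc_zero_one_unitInterval] at h
    simpa using h
  refine h1.trans ?_
  rw [h2, mul_one]
  rfl

/-! ### The unfolded strip -/

theorem along_targetImage (d : RollDir) (T : GridPlane) :
    d.along (targetImage [d, d] T 0) (targetImage [d, d] T 1) = 4 - d.along (T 0) (T 1) := by
  cases d <;> simp [RollDir.along, targetImage, place, placeFrom, rollFrom, rollBase, topPoint,
    RollDir.vec] <;> ring

theorem across_targetImage (d : RollDir) (T : GridPlane) :
    d.across (targetImage [d, d] T 0) (targetImage [d, d] T 1) = d.across (T 0) (T 1) := by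
  cases d <;> simp [RollDir.across, targetImage, place, placeFrom, rollFrom, rollBase, topPoint,
    RollDir.vec]

theorem dist_targetImage (d : RollDir) (S T : GridPlane) :
    dist S (targetImage [d, d] T) = stripDist d S T := by
  rw [EuclideanSpace.dist_eq, Fin.sum_univ_two, stripDist, Real.dist_eq, Real.dist_eq, sq_abs,
    sq_abs, sub_right_comm, ← along_targetImage, ← across_targetImage d T]
  congr 1
  cases d <;> simp only [RollDir.along, RollDir.across] <;> ring

theorem along_lineMap (d : RollDir) (P Q : GridPlane) (t : ℝ) :
    d.along (AffineMap.lineMap P Q t 0) (AffineMap.lineMap P Q t 1) =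
      d.along (P 0) (P 1) + t * (d.along (Q 0) (Q 1) - d.along (P 0) (P 1)) := by
  cases d <;> simp [RollDir.along, AffineMap.lineMap_apply_module] <;> ring

theorem across_lineMap (d : RollDir) (P Q : GridPlane) (t : ℝ) :
    d.across (AffineMap.lineMap P Q t 0) (AffineMap.lineMap P Q t 1) =
      d.across (P 0) (P 1) + t * (d.across (Q 0) (Q 1) - d.across (P 0) (P 1)) := by
  cases d <;> simp [RollDir.across, AffineMap.lineMap_apply_module] <;> ring

theorem mem_cell_iff (d : RollDir) (n : ℕ) (q : GridPlane) :
    q ∈ cell (List.replicate n d) ↔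
      |d.along (q 0) (q 1) - 2 * n| ≤ 1 ∧ |d.across (q 0) (q 1)| ≤ 1 := by
  have h : cellCentre (List.replicate n d) = (2 * n : ℝ) • d.vec := by
    rw [cellCentre, List.map_replicate, List.sum_replicate, ← Nat.cast_smul_eq_nsmul ℝ, smul_smul,
      mul_comm]
  rw [cell, mem_ofPred_eq, h, Fin.forall_fin_two]
  have h1 : |q 0 + 2 * n| = |-q 0 - 2 * n| := by rw [← abs_neg]; ring_nf
  have h2 : |q 1 + 2 * n| = |-q 1 - 2 * n| := by rw [← abs_neg]; ring_nf
  cases d <;> simp [RollDir.vec, RollDir.along, RollDir.across, and_comm, h1, h2]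

theorem replicate_prefix (d : RollDir) {n : ℕ} (hn : n ≤ 2) : List.replicate n d <+: [d, d] :=
  ⟨List.replicate (2 - n) d, by rw [List.replicate_append_replicate, Nat.add_sub_cancel' hn]; rfl⟩

/-- Each point of the strip lies in one of its three squares. -/
theorem exists_strip_square {u : ℝ} (hu : -1 ≤ u) (hu' : u ≤ 5) :
    ∃ n : ℕ, n ≤ 2 ∧ |u - 2 * n| ≤ 1 := by
  rcases le_total u 1 with h | h
  · exact ⟨0, by norm_num, abs_le.2 (by constructor <;> push_cast <;> linarith)⟩
  rcases le_total u 3 with h' | h'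
  · exact ⟨1, by norm_num, abs_le.2 (by constructor <;> push_cast <;> linarith)⟩
  · exact ⟨2, by norm_num, abs_le.2 (by constructor <;> push_cast <;> linarith)⟩

theorem mem_unfolding_of_strip (d : RollDir) {q : GridPlane} (hu : -1 ≤ d.along (q 0) (q 1))
    (hu' : d.along (q 0) (q 1) ≤ 5) (hv : |d.across (q 0) (q 1)| ≤ 1) : q ∈ unfolding [d, d] := by
  obtain ⟨n, hn, hq⟩ := exists_strip_square hu hu'
  exact ⟨_, replicate_prefix d hn, (mem_cell_iff d n q).2 ⟨hq, hv⟩⟩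

theorem isLocallyShortest_strip (d : RollDir) {S T : GridPlane} (hS : ∀ i, |S i| < 1)
    (hT : ∀ i, |T i| < 1) : IsLocallyShortest [d, d] S T := by
  have hopen : IsOpen ({q : GridPlane | -1 < d.along (q 0) (q 1)} ∩
      ({q | d.along (q 0) (q 1) < 5} ∩ {q | |d.across (q 0) (q 1)| < 1})) := by
    have h1 : Continuous fun q : GridPlane => d.along (q 0) (q 1) := by
      cases d <;> simp only [RollDir.along] <;> fun_prop
    have h2 : Continuous fun q : GridPlane => d.across (q 0) (q 1) := by
      cases d <;> simp only [RollDir.across] <;> fun_prop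
    exact (isOpen_lt continuous_const h1).inter
      ((isOpen_lt h1 continuous_const).inter (isOpen_lt h2.abs continuous_const))
  refine fun q hq => mem_interior.2 ⟨_, fun p hp => mem_unfolding_of_strip d
    (le_of_lt hp.1) (le_of_lt hp.2.1) (le_of_lt hp.2.2), hopen, ?_⟩
  rw [segment_eq_image_lineMap] at hq
  obtain ⟨t, ⟨ht0, ht1⟩, rfl⟩ := hq
  obtain ⟨⟨h1, h2⟩, h3⟩ := strip_coords_mem d hS hT ht0 ht1
  rw [mem_inter_iff, mem_inter_iff, mem_ofPred_eq, mem_ofPred_eq, mem_ofPred_eq, along_lineMap,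
    across_lineMap, along_targetImage, across_targetImage, sub_right_comm]
  exact ⟨h1, h2, h3⟩

/-- Folding inverts rolling: on the square reached after `n` rolls, `n = 0, 1, 2`, the placement of
the cube carries the folded point back to `q`. -/
theorem printedAt_foldPoint (d : RollDir) {q : GridPlane} (hu : -1 ≤ d.along (q 0) (q 1))
    (hu' : d.along (q 0) (q 1) ≤ 5) (hv : |d.across (q 0) (q 1)| ≤ 1) :
    PrintedAt [d, d] (foldPoint d (d.along (q 0) (q 1)) (d.across (q 0) (q 1))) q := by
  unfold foldPoint
  rcases foldPoint_coords (d.along (q 0) (q 1)) with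
    ⟨h1, h2, h3⟩ | ⟨h1, h1', h2, h3⟩ | ⟨h1, h2, h3⟩ <;> rw [h2, h3]
  · refine ⟨_, replicate_prefix d zero_le_two, (mem_cell_iff d 0 q).2
      ⟨abs_le.2 (by constructor <;> push_cast <;> linarith), hv⟩, ?_⟩
    ext i
    cases d <;> fin_cases i <;>
      simp [place, placeFrom, bottomPoint, RollDir.point, RollDir.along, RollDir.across]
  · refine ⟨_, replicate_prefix d one_le_two, (mem_cell_iff d 1 q).2
      ⟨abs_le.2 (by constructor <;> push_cast <;> linarith), hv⟩, ?_⟩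
    ext i
    cases d <;> fin_cases i <;>
      simp [place, placeFrom, rollFrom, rollBase, bottomPoint, RollDir.point, RollDir.along,
        RollDir.across] <;> ring
  · refine ⟨_, replicate_prefix d le_rfl, (mem_cell_iff d 2 q).2
      ⟨abs_le.2 (by constructor <;> push_cast <;> linarith), hv⟩, ?_⟩
    ext i
    cases d <;> fin_cases i <;>
      simp [List.replicate, place, placeFrom, rollFrom, rollBase, bottomPoint, RollDir.point,
        RollDir.along, RollDir.across, RollDir.vec] <;> ring

theorem isLSPath_of_eq_foldPoint (d : RollDir) {S T : GridPlane} (hS : ∀ i, |S i| < 1)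
    (hT : ∀ i, |T i| < 1) (γ : Path (bottomPoint S) (topPoint T)) {φ : unitInterval → ℝ}
    (hφ : Continuous φ) (hmono : Monotone φ) (hφ0 : φ 0 = 0) (hφ1 : φ 1 = 1)
    (hfold : ∀ t, γ t = stripLine d S T (φ t)) : IsLSPath [d, d] S T γ := by
  refine ⟨isLocallyShortest_strip d hS hT, φ, hφ, hmono, hφ0, hφ1, fun t => ?_⟩
  obtain ⟨⟨h1, h2⟩, h3⟩ := strip_coords_mem d hS hT
    (hφ0.symm.le.trans (hmono (unitInterval.nonneg' : 0 ≤ t)))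
    ((hmono (unitInterval.le_one' : t ≤ 1)).trans hφ1.le)
  rw [hfold, stripLine]
  have hu := along_lineMap d S (targetImage [d, d] T) (φ t)
  have hv := across_lineMap d S (targetImage [d, d] T) (φ t)
  rw [along_targetImage, sub_right_comm] at hu
  rw [across_targetImage] at hv
  rw [← hu] at h1 h2 ⊢
  rw [← hv] at h3 ⊢
  exact printedAt_foldPoint d h1.le h2.le h3.le

theorem foldPoint_mem_cubeFace (d : RollDir) {u v : ℝ} (hu : -1 < u) (hu' : u < 5)
    (hv : |v| < 1) {i : Fin 3 × Bool} (hi : foldPoint d u v ∈ cubeFace i) :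
    i ∈ ({(2, false), d.face, (2, true)} : Set (Fin 3 × Bool)) := by
  have hα : -1 < min u (min 1 (4 - u)) := lt_min hu (lt_min (by norm_num) (by linarith))
  have hv := abs_lt.1 hv
  have h := hi.2
  rw [foldPoint] at h
  set α := min u (min 1 (4 - u))
  obtain ⟨i, b⟩ := i
  fin_cases i <;> cases b <;> cases d <;> simp [RollDir.point, RollDir.face] at h ⊢ <;> linarith

theorem ncard_facesMet_of_eq_foldPoint (d : RollDir) {S T : GridPlane} (hS : ∀ i, |S i| < 1)
    (hT : ∀ i, |T i| < 1) (γ : Path (bottomPoint S) (topPoint T)) {φ : unitInterval → ℝ}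
    (hφ : Continuous φ) (hmono : Monotone φ) (hφ0 : φ 0 = 0) (hφ1 : φ 1 = 1)
    (hfold : ∀ t, γ t = stripLine d S T (φ t)) : (facesMet γ).ncard = 3 := by
  have hcoords := fun t : unitInterval => strip_coords_mem d hS hT
    (hφ0.symm.le.trans (hmono (unitInterval.nonneg' : 0 ≤ t)))
    ((hmono (unitInterval.le_one' : t ≤ 1)).trans hφ1.le)
  have hsurf : ∀ t, γ t ∈ cubeSurface := fun t => by
    obtain ⟨⟨h1, h2⟩, h3⟩ := hcoords t
    rw [hfold]
    exact foldPoint_mem_cubeSurface d h1.le h2.le h3.le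
  have hset : facesMet γ = {(2, false), d.face, (2, true)} := by
    refine Subset.antisymm (fun i ⟨t, ht⟩ => ?_) ?_
    · obtain ⟨⟨h1, h2⟩, h3⟩ := hcoords t
      rw [hfold] at ht
      exact foldPoint_mem_cubeFace d h1 h2 h3 ht
    · rintro i (rfl | rfl | rfl)
      · exact ⟨0, hsurf 0, by rw [γ.source]; simp [bottomPoint]⟩
      · have hS' := abs_lt.1 (abs_along_lt_one d hS)
        have hT' := abs_lt.1 (abs_along_lt_one d hT)
        have hc : Continuous fun t => d.along (S 0) (S 1) +
            φ t * (4 - d.along (S 0) (S 1) - d.along (T 0) (T 1)) := by fun_prop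
        -- The value `2` is the middle of the side square, and the segment starts before it and ends
        -- beyond it.
        obtain ⟨t, ht⟩ := mem_range_of_exists_le_of_exists_ge hc (c := 2)
          ⟨0, by rw [hφ0]; linarith⟩ ⟨1, by rw [hφ1]; linarith⟩
        beta_reduce at ht
        refine ⟨t, hsurf t, ?_⟩
        rw [hfold, stripLine, ht, foldPoint]
        cases d <;> norm_num [RollDir.face, RollDir.point]
      · exact ⟨1, hsurf 1, by rw [γ.target]; simp [topPoint]⟩
  rw [hset]
  exact ncard_eq_three.2 ⟨_, _, _, by cases d <;> simp [RollDir.face], by simp,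
    by cases d <;> simp [RollDir.face], rfl⟩

/-! ### Corner moves -/

/-- The hypothesis says `cos² < 1/2`, a form free of square roots that suits polynomial arithmetic.
-/
theorem angle_lt_of_two_mul_inner_sq_lt {V : Type*} [NormedAddCommGroup V]
    [InnerProductSpace ℝ V] {x y : V} (h : 2 * inner ℝ x y ^ 2 < ‖x‖ ^ 2 * ‖y‖ ^ 2) :
    InnerProductGeometry.angle x y < 3 * Real.pi / 4 := by
  by_contra! hle
  have hcos := Real.cos_le_cos_of_nonneg_of_le_pi (by positivity)
    (InnerProductGeometry.angle_le_pi x y) hle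
  have h34 : Real.cos (3 * Real.pi / 4) = -(√2 / 2) := by
    rw [show 3 * Real.pi / 4 = Real.pi - Real.pi / 4 by ring, Real.cos_pi_sub, Real.cos_pi_div_four]
  have hmul := InnerProductGeometry.cos_angle_mul_norm_mul_norm x y
  rw [h34] at hcos
  have hn : 0 ≤ ‖x‖ * ‖y‖ := by positivity
  have h2 : √2 ^ 2 = 2 := Real.sq_sqrt (by norm_num)
  have h1 : (√2 / 2) * (‖x‖ * ‖y‖) ≤ -inner ℝ x y := by
    rw [← hmul, ← neg_mul]
    exact mul_le_mul_of_nonneg_right (by linarith) hn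
  have h3 := pow_le_pow_left₀ (by positivity) h1 2
  rw [mul_pow, mul_pow, div_pow, h2] at h3
  linarith

/-- Up to symmetry these products are the slack in the decision-angle inequality. If `A` and `B` are
the distances along and across from the pivot to the non-centroid endpoint, the other vector is
diagonal and the inequality becomes `(A - B)² < A² + B²`. -/
theorem mul_pos_of_abs_lt_one {x y : ℝ} (hx : |x| < 1) (hy : |y| < 1) :
    (0 < (3 - x) * (1 - y) ∧ 0 < (3 - x) * (1 + y)) ∧
      0 < (3 + x) * (1 - y) ∧ 0 < (3 + x) * (1 + y) := by
  have hx := abs_lt.1 hx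
  have hy := abs_lt.1 hy
  refine ⟨⟨?_, ?_⟩, ?_, ?_⟩ <;> apply mul_pos <;> linarith

/-- The swing moves the centroid image from `4d` to `4d + 2e`. The bisector of these points is the
line of `e`-coordinate `1`, and `S` lies strictly on the side of `4d`. -/
theorem target_corner_move {S : GridPlane} (hS : ∀ i, |S i| < 1) (d e : RollDir)
    (hde : inner ℝ d.vec e.vec = 0) :
    ∠ S (targetPivot d e) (targetImage [d, d] 0) < 3 * Real.pi / 4 ∧
      dist S (targetImage [d, d] 0) < dist S (targetImage [d, e, d] 0) := by
  obtain ⟨⟨a1, a2⟩, a3, a4⟩ := mul_pos_of_abs_lt_one (hS 0) (hS 1)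
  obtain ⟨⟨b1, b2⟩, b3, b4⟩ := mul_pos_of_abs_lt_one (hS 1) (hS 0)
  have h0 := abs_lt.1 (hS 0)
  have h1 := abs_lt.1 (hS 1)
  constructor
  · apply angle_lt_of_two_mul_inner_sq_lt
    rw [EuclideanSpace.norm_sq_eq, EuclideanSpace.norm_sq_eq]
    cases d <;> cases e <;> simp [RollDir.vec, PiLp.inner_apply, Fin.sum_univ_two] at hde <;>
      simp [RollDir.vec, PiLp.inner_apply, Fin.sum_univ_two, targetPivot, targetImage, place,
        placeFrom, rollFrom, rollBase, topPoint, sq_abs] <;> nlinarith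
  · rw [EuclideanSpace.dist_eq, EuclideanSpace.dist_eq]
    apply Real.sqrt_lt_sqrt (by positivity)
    cases d <;> cases e <;> simp [RollDir.vec, PiLp.inner_apply, Fin.sum_univ_two] at hde <;>
      simp [RollDir.vec, Fin.sum_univ_two, targetImage, place,
        placeFrom, rollFrom, rollBase, topPoint, Real.dist_eq, sq_abs] <;> nlinarith

theorem source_corner_move {T : GridPlane} (hT : ∀ i, |T i| < 1) (d e : RollDir)
    (hde : inner ℝ d.vec e.vec = 0) :
    ∠ 0 (sourcePivot d e) (targetImage [d, d] T) < 3 * Real.pi / 4 ∧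
      dist 0 (targetImage [d, d] T) < dist 0 (targetImage [e, d, e] T) := by
  obtain ⟨⟨a1, a2⟩, a3, a4⟩ := mul_pos_of_abs_lt_one (hT 0) (hT 1)
  obtain ⟨⟨b1, b2⟩, b3, b4⟩ := mul_pos_of_abs_lt_one (hT 1) (hT 0)
  have h0 := abs_lt.1 (hT 0)
  have h1 := abs_lt.1 (hT 1)
  constructor
  · apply angle_lt_of_two_mul_inner_sq_lt
    rw [EuclideanSpace.norm_sq_eq, EuclideanSpace.norm_sq_eq]
    cases d <;> cases e <;> simp [RollDir.vec, PiLp.inner_apply, Fin.sum_univ_two] at hde <;>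
      simp [RollDir.vec, PiLp.inner_apply, Fin.sum_univ_two, sourcePivot, targetImage, place,
        placeFrom, rollFrom, rollBase, topPoint, sq_abs] <;> nlinarith
  · rw [EuclideanSpace.dist_eq, EuclideanSpace.dist_eq]
    apply Real.sqrt_lt_sqrt (by positivity)
    cases d <;> cases e <;> simp [RollDir.vec, PiLp.inner_apply, Fin.sum_univ_two] at hde <;>
      simp [RollDir.vec, Fin.sum_univ_two, targetImage, place,
        placeFrom, rollFrom, rollBase, topPoint, Real.dist_eq, sq_abs] <;> nlinarith

theorem mainTheorem4 (S T : GridPlane) (hS : ∀ i, |S i| < 1) (hT : ∀ i, |T i| < 1)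
    (hcentroid : S = 0 ∨ T = 0) :
    -- all four 3-face paths RR, UU, LL, DD are locally shortest paths
    (∀ d : RollDir, IsLocallyShortest [d, d] S T) ∧
    -- centroid target: decision angles, and no corner move shortens a 3-face path
    (T = 0 → ∀ d e : RollDir, inner ℝ d.vec e.vec = 0 →
      ∠ S (targetPivot d e) (targetImage [d, d] T) < 3 * Real.pi / 4 ∧
      dist S (targetImage [d, d] T) < dist S (targetImage [d, e, d] T)) ∧
    -- centroid source: decision angles, and no corner move shortens a 3-face path
    (S = 0 → ∀ d e : RollDir, inner ℝ d.vec e.vec = 0 →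
      ∠ S (sourcePivot d e) (targetImage [d, d] T) < 3 * Real.pi / 4 ∧
      dist S (targetImage [d, d] T) < dist S (targetImage [e, d, e] T)) ∧
    -- there is a shortest path, and every shortest path is one of the four 3-face paths
    (∃ γ : Path (bottomPoint S) (topPoint T), IsShortestSurfacePath γ) ∧
    (∀ γ : Path (bottomPoint S) (topPoint T), IsShortestSurfacePath γ →
      (∃ d : RollDir, IsLSPath [d, d] S T γ ∧
        pathLength γ = ENNReal.ofReal (dist S (targetImage [d, d] T))) ∧
      (facesMet γ).ncard = 3) := by
  have hmin : StripMinimal S T := by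
    rcases hcentroid with rfl | rfl
    · exact (stripMinimal_zero hT).symm
    · exact stripMinimal_zero hS
  refine ⟨fun d => isLocallyShortest_strip d hS hT, ?_, ?_, ?_, fun γ hγ => ?_⟩
  · rintro rfl d e hde
    exact target_corner_move hS d e hde
  · rintro rfl d e hde
    exact source_corner_move hT d e hde
  · obtain ⟨d, hd⟩ := hmin.1
    exact ⟨stripPath d hS hT, stripPath_mem_cubeSurface d hS hT, fun γ' hγ' =>
      (pathLength_stripPath_le d hS hT).trans (hd γ' γ'.continuous hγ' γ'.source γ'.target)⟩
  · obtain ⟨d, φ, hφ, hmono, hφ0, hφ1, hfold, hlen⟩ := hmin.2 γ γ.continuous hγ.1 γ.source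
      γ.target fun d => (hγ.2 _ (stripPath_mem_cubeSurface d hS hT)).trans
        (pathLength_stripPath_le d hS hT)
    exact ⟨⟨d, isLSPath_of_eq_foldPoint d hS hT γ hφ hmono hφ0 hφ1 hfold,
      (dist_targetImage d S T).symm ▸ hlen⟩,
      ncard_facesMet_of_eq_foldPoint d hS hT γ hφ hmono hφ0 hφ1 hfold⟩
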